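/- Let $f\colon\mathbb{R}^d\to\mathbb{R}$ be piecewise affine, i.e. there are finitely many polyhedral sets $Q_1,\dots,Q_k$ (finite intersections of closed half-spaces) with nonempty, pairwise disjoint interiors and with union $\mathbb{R}^d$, such that $f$ is affine on each $Q_i$. Suppose that $f$ is bounded below. Then: (1) $f$ attains its global minimum. (2) $f$ has a representation $$f(x)=\underline f(x)+\overline f(x),\qquad \underline f(x)=\max_{1\le i\le l}(a_i+\langle v_i,x\rangle),\qquad \overline f(x)=\min_{1\le j\le s}(b_j+\langle w_j,x\rangle)\qquad(*)$$ with $l,s\ge1$, $a_i,b_j\in\mathbb{R}$, $v_i,w_j\in\mathbb{R}^d$. (3) Fix any representation $(*)$ and any starting point $x_0\in\mathbb{R}^d$. For $x\in\mathbb{R}^d$ and $j\in J=\{1,\dots,s\}$ put $$\underline d f(x)=\mathrm{co}\{(a_i-\underline f(x)+\langle v_i,x\rangle,\,v_i): 1\le i\le l\}\subset\mathbb{R}\times\mathbb{R}^d,\qquad z_j(x)=(b_j-\overline f(x)+\langle w_j,x\rangle,\,w_j),$$ and let $(a_j(x),v_j(x))$ be the point of least Euclidean norm in $\underline d f(x)+z_j(x)$.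 The method of global codifferential descent starts with $n=0$, $M=J$, and repeats the following: remove from $M$ all $j$ with $a_j(x_n)\ge0$; if $M=\emptyset$, stop; otherwise choose $j(n)\in M$ minimizing $f\big(x_n+a_j(x_n)^{-1}v_j(x_n)\big)$ over $j\in M$, set $x_{n+1}=x_n+a_{j(n)}(x_n)^{-1}v_{j(n)}(x_n)$, and increase $n$ by one. The method can be carried out from $x_0$, and, whatever choices of the minimizing indices $j(n)$ are made, it stops after finitely many steps at a point $x_N$ of global minimum of $f$, the number $N$ of updates being at most $s\,n^*$, where $$n^*=\Big\lfloor \frac{f(x_0)-\inf f}{\min\{\theta,1\}}\Big\rfloor+1,\qquad \theta=\min_{C\in\mathcal E}\min_{v\in C}\|v\|^2,$$ and $\mathcal E$ is the finite family of all sets $C=\mathrm{co}\{v_i: i\in S\}+w_j$ with $\emptyset\ne S\subseteq\{1,\dots,l\}$, $j\in J$, and $0\notin C$ ($\theta=+\infty$ if $\mathcal E=\emptyset$). -/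

import Mathlib

open scoped Pointwise

/-! ### Piecewise affine functions -/

/-- A polyhedral set: the intersection of a finite family of closed half-spaces. -/
def IsPolyhedral {d : ℕ} (Q : Set (EuclideanSpace ℝ (Fin d))) : Prop :=
  ∃ (m : ℕ) (c : Fin m → EuclideanSpace ℝ (Fin d)) (β : Fin m → ℝ),
    (∀ r, c r ≠ 0) ∧ Q = ⋂ r, {x | inner ℝ (c r) x ≤ β r}

/-- A polyhedral partition of `ℝ^d`: finitely many polyhedral sets with nonempty and mutually
disjoint interiors, covering the space. -/
structure IsPolyhedralPartition {d k : ℕ} (Q : Fin k → Set (EuclideanSpace ℝ (Fin d))) :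
    Prop where
  polyhedral : ∀ i, IsPolyhedral (Q i)
  cover : ⋃ i, Q i = Set.univ
  interior_nonempty : ∀ i, (interior (Q i)).Nonempty
  interior_disjoint : ∀ i j, i ≠ j → Disjoint (interior (Q i)) (interior (Q j))

/-- `f` is piecewise affine: its restriction to each member of some polyhedral partition of `ℝ^d`
is affine. -/
def IsPiecewiseAffine {d : ℕ} (f : EuclideanSpace ℝ (Fin d) → ℝ) : Prop :=
  ∃ (k : ℕ) (Q : Fin k → Set (EuclideanSpace ℝ (Fin d))), IsPolyhedralPartition Q ∧
    ∀ i, ∃ A : EuclideanSpace ℝ (Fin d) →ᵃ[ℝ] ℝ, ∀ x ∈ Q i, f x = A x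

/-! ### DC decompositions and global codifferentials -/

/-- The coefficients `(a_i, v_i)`, `i ∈ I`, and `(b_j, w_j)`, `j ∈ J`, of a function of the form
`max_i (a_i + ⟨v_i, x⟩) + min_j (b_j + ⟨w_j, x⟩)`, where `|I| = l` and `|J| = s`. -/
structure DCDecomposition (d l s : ℕ) where
  a : Fin l → ℝ
  v : Fin l → EuclideanSpace ℝ (Fin d)
  b : Fin s → ℝ
  w : Fin s → EuclideanSpace ℝ (Fin d)

namespace DCDecomposition

noncomputable section

variable {d l s : ℕ} [NeZero l] [NeZero s] (D : DCDecomposition d l s)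

/-- The convex part `max_i (a_i + ⟨v_i, x⟩)`. -/
def convexPart (x : EuclideanSpace ℝ (Fin d)) : ℝ :=
  Finset.univ.sup' Finset.univ_nonempty fun i : Fin l => D.a i + inner ℝ (D.v i) x

/-- The concave part `min_j (b_j + ⟨w_j, x⟩)`. -/
def concavePart (x : EuclideanSpace ℝ (Fin d)) : ℝ :=
  Finset.univ.inf' Finset.univ_nonempty fun j : Fin s => D.b j + inner ℝ (D.w j) x

/-- `D` is a DC decomposition of the function `f`. -/
def Represents (f : EuclideanSpace ℝ (Fin d) → ℝ) : Prop :=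
  ∀ x, f x = D.convexPart x + D.concavePart x

/-- The global hypodifferential at `x`, a polytope in `ℝ × ℝ^d` with the Euclidean norm. -/
def hypodiff (x : EuclideanSpace ℝ (Fin d)) : Set (WithLp 2 (ℝ × EuclideanSpace ℝ (Fin d))) :=
  convexHull ℝ (Set.range fun i : Fin l =>
    WithLp.toLp 2 (D.a i - D.convexPart x + inner ℝ (D.v i) x, D.v i))

/-- The point `z_j(x) = (b_j - min_k (b_k + ⟨w_k, x⟩) + ⟨w_j, x⟩, w_j)` of the global
hyperdifferential at `x`. -/
def z (x : EuclideanSpace ℝ (Fin d)) (j : Fin s) : WithLp 2 (ℝ × EuclideanSpace ℝ (Fin d)) :=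
  WithLp.toLp 2 (D.b j - D.concavePart x + inner ℝ (D.w j) x, D.w j)

theorem exists_leastNorm (x : EuclideanSpace ℝ (Fin d)) (j : Fin s) :
    ∃ p ∈ D.hypodiff x + {D.z x j}, ∀ q ∈ D.hypodiff x + {D.z x j}, ‖p‖ ≤ ‖q‖ := by
  have hc : IsCompact (D.hypodiff x + {D.z x j}) :=
    ((Set.finite_range _).isCompact_convexHull ℝ).add isCompact_singleton
  have hn : (D.hypodiff x + {D.z x j}).Nonempty :=
    ((Set.range_nonempty _).convexHull).add (Set.singleton_nonempty _)
  obtain ⟨p, hp, h⟩ := hc.exists_isMinOn hn continuous_norm.continuousOn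
  exact ⟨p, hp, fun q hq => h hq⟩

/-- The pair `(a_j(x), v_j(x))`: the (unique) point of least Euclidean norm in the polytope
`hypodiff x + z_j(x)`. -/
def proj (x : EuclideanSpace ℝ (Fin d)) (j : Fin s) : WithLp 2 (ℝ × EuclideanSpace ℝ (Fin d)) :=
  (D.exists_leastNorm x j).choose

theorem proj_mem (x : EuclideanSpace ℝ (Fin d)) (j : Fin s) :
    D.proj x j ∈ D.hypodiff x + {D.z x j} :=
  (D.exists_leastNorm x j).choose_spec.1

theorem norm_proj_le (x : EuclideanSpace ℝ (Fin d)) (j : Fin s)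
    {q : WithLp 2 (ℝ × EuclideanSpace ℝ (Fin d))} (hq : q ∈ D.hypodiff x + {D.z x j}) :
    ‖D.proj x j‖ ≤ ‖q‖ :=
  (D.exists_leastNorm x j).choose_spec.2 q hq

/-- The trial point `x + a_j(x)⁻¹ v_j(x)` (used only when `a_j(x) < 0`). -/
def trial (x : EuclideanSpace ℝ (Fin d)) (j : Fin s) : EuclideanSpace ℝ (Fin d) :=
  x + (D.proj x j).fst⁻¹ • (D.proj x j).snd

/-! ### The method of global codifferential descent -/

/-- The sequences `x` and `M` are produced by the method of global codifferential descent applied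
to `f` with the starting point `x₀`. Here `M n` is the set of indices that are still kept after the
discarding step of iteration `n`; the method stops at the first `n` with `M n = ∅`, and no
condition is imposed on the terms that follow. The selected index is an arbitrary minimizer of
`f (trial (x n) j)` over `j ∈ M n`. -/
structure IsRun (f : EuclideanSpace ℝ (Fin d) → ℝ) (x₀ : EuclideanSpace ℝ (Fin d))
    (x : ℕ → EuclideanSpace ℝ (Fin d)) (M : ℕ → Set (Fin s)) : Prop where
  start : x 0 = x₀
  discard_zero : M 0 = Set.univ \ {j | 0 ≤ (D.proj (x 0) j).fst}
  step : ∀ n, (M n).Nonempty →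
    ∃ j ∈ M n, (∀ i ∈ M n, f (D.trial (x n) j) ≤ f (D.trial (x n) i)) ∧
      x (n + 1) = D.trial (x n) j
  discard_succ : ∀ n, (M n).Nonempty →
    M (n + 1) = M n \ {j | 0 ≤ (D.proj (x (n + 1)) j).fst}

/-! ### The iteration bound -/

/-- The finite family of all sets `C = co {v_i | i ∈ S} + w_j`, with `S` a nonempty set of indices,
that do not contain the origin. -/
def gradientSets : Set (Set (EuclideanSpace ℝ (Fin d))) :=
  {C | (∃ S : Set (Fin l), S.Nonempty ∧ ∃ j : Fin s, C = convexHull ℝ (D.v '' S) + {D.w j}) ∧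
    (0 : EuclideanSpace ℝ (Fin d)) ∉ C}

/-- The number `min {θ, 1}`, where `θ` is the minimum of `‖v‖²` over all `v ∈ C ∈ gradientSets`
(`θ = +∞` if there are no such sets). -/
def minThetaOne : ℝ :=
  sInf (insert 1 {r : ℝ | ∃ C ∈ D.gradientSets, ∃ v ∈ C, r = ‖v‖ ^ 2})

/-- The number `n* = ⌊(f(x₀) - inf f) / min {θ, 1}⌋ + 1`. -/
def nStar (f : EuclideanSpace ℝ (Fin d) → ℝ) (x₀ : EuclideanSpace ℝ (Fin d)) : ℕ :=
  ⌊(f x₀ - ⨅ y, f y) / D.minThetaOne⌋₊ + 1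

end

end DCDecomposition

/-!
A continuous selection `f` of finitely many affine functions `A i` is a maximum of minima of them:
on the segment from `x` to `y` some `A i` with `A i x ≤ f x` stays ahead of `f`, so that
`min {A i | f y ≤ A i y}` is at most `f` everywhere and at least `f` at `y`. Differences of maxima
of affine functions form a lattice, which gives the DC decomposition.

A DC decomposition exhibits `f` as the minimum of the convex branches
`F j = max_i (a i + ⟨v i, ·⟩) + (b j + ⟨w j, ·⟩)`, and `x` minimizes `f` as soon as `f x` bounds
every branch from below. If the nearest point `p` of the polytope `hypodiff x + z j` to the origin
has first component `a < 0`, then at the trial point `F j` is at most `f x + ‖p‖² / a`. Let `C` be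
the projection to `ℝ^d` of the face of the polytope exposed by `p`. If `0 ∈ C`, a point of the face
above `0` shows that `f x + ‖p‖² / a` is a lower bound of `F j`, so `j` is discarded at the next
step and stays discarded. If `0 ∉ C`, then `C` is one of the sets that define `θ`, and `f` drops by
at least `min {θ, 1}`. Hence the number of surviving indices plus
`⌊(f x - inf f) / min {θ, 1}⌋` decreases strictly along the method.
-/

open Filter Topology

/-! ### Continuous selections of affine functions -/

theorem eventually_exists_eq_and_eq_of_selection {X Y ι : Type*} [TopologicalSpace X]
    [TopologicalSpace Y] [T2Space Y] [Finite ι] {f : X → Y} {g : ι → X → Y} {x : X}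
    (hf : ContinuousAt f x) (hg : ∀ i, ContinuousAt (g i) x) (hsel : ∀ u, ∃ i, f u = g i u) :
    ∀ᶠ u in 𝓝 x, ∃ i, f u = g i u ∧ f x = g i x := by
  have h : ∀ i, ∀ᶠ u in 𝓝 x, f u = g i u → f x = g i x := fun i => by
    by_cases hi : f x = g i x
    · exact .of_forall fun _ _ => hi
    · exact ((hf.ne_iff_eventually_ne (hg i)).1 hi).mono fun u hne heq => absurd heq hne
  filter_upwards [eventually_all.2 h] with u hu
  obtain ⟨i, hi⟩ := hsel u
  exact ⟨i, hi, hu i hi⟩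

theorem exists_le_and_ge_of_continuous_selection_real {ι : Type*} [Finite ι] {ψ : ℝ → ℝ}
    (hψ : Continuous ψ) {p m : ι → ℝ} (hsel : ∀ t, ∃ i, ψ t = p i + t * m i) :
    ∃ i, p i ≤ ψ 0 ∧ ψ 1 ≤ p i + m i := by
  set C : Set ℝ := {t | ∃ i, p i ≤ ψ 0 ∧ ψ t ≤ p i + t * m i} with hC
  have hclosed : IsClosed C := by
    simp only [hC, Set.ofPred_exists]
    exact isClosed_iUnion_of_finite fun i =>
      isClosed_const.and (isClosed_le hψ (by fun_prop))
  have hzero : (0 : ℝ) ∈ C := by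
    obtain ⟨i, hi⟩ := hsel 0
    exact ⟨i, by simp [hi], hi.le⟩
  suffices Set.Icc 0 1 ⊆ C by simpa [hC] using this (Set.right_mem_Icc.2 zero_le_one)
  refine (hclosed.inter isClosed_Icc).Icc_subset_of_forall_exists_gt hzero ?_
  rintro t ⟨⟨k, hk0, hkt⟩, ht0, -⟩ y hy
  have hright : ∀ᶠ u in 𝓝[>] t, u ∈ C := by
    rcases hkt.lt_or_eq with hlt | heq
    · have hlt' := hψ.continuousAt.eventually_lt (g := fun t => p k + t * m k) (by fun_prop) hlt
      exact nhdsWithin_le_nhds (hlt'.mono fun u hu => ⟨k, hk0, hu.le⟩)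
    · have hact := eventually_exists_eq_and_eq_of_selection (x := t) (g := fun i t => p i + t * m i)
        hψ.continuousAt (by fun_prop) hsel
      filter_upwards [nhdsWithin_le_nhds hact, self_mem_nhdsWithin] with u ⟨i, hiu, hit⟩ htu
      by_cases hi : p i ≤ ψ 0
      · exact ⟨i, hi, hiu.le⟩
      · -- The `i`-th line starts above the `k`-th and meets it at `t`, so it is below it after `t`.
        have hslope : m i ≤ m k := by nlinarith [heq.symm.trans hit]
        refine ⟨k, hk0, ?_⟩
        nlinarith [mul_le_mul_of_nonneg_left hslope (sub_nonneg.2 (Set.mem_Ioi.1 htu).le)]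
  exact (hright.and (Ioc_mem_nhdsGT hy)).exists

section

variable {E ι : Type*} [AddCommGroup E] [Module ℝ E] [TopologicalSpace E]
  [IsTopologicalAddGroup E] [ContinuousSMul ℝ E] [Finite ι] {f : E → ℝ} {A : ι → E →ᵃ[ℝ] ℝ}

theorem exists_le_and_ge_of_continuous_selection (hf : Continuous f)
    (hsel : ∀ x, ∃ i, f x = A i x) (x y : E) : ∃ i, A i x ≤ f x ∧ f y ≤ A i y := by
  have hline : ∀ t, ∃ i, f (AffineMap.lineMap x y t) = A i x + t * (A i y - A i x) := fun t => by
    obtain ⟨i, hi⟩ := hsel (AffineMap.lineMap x y t)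
    refine ⟨i, ?_⟩
    rw [hi, AffineMap.apply_lineMap, AffineMap.lineMap_apply_ring', add_comm]
  simpa using exists_le_and_ge_of_continuous_selection_real
    (hf.comp AffineMap.lineMap_continuous) hline

theorem mem_latticeClosure_of_continuous_selection (hf : Continuous f)
    (hsel : ∀ x, ∃ i, f x = A i x) : f ∈ latticeClosure (Set.range fun i x => A i x) := by
  classical
  have := Fintype.ofFinite ι
  let minOf (S : {S : Finset ι // S.Nonempty}) : E → ℝ := S.1.inf' S.2 fun i x => A i x
  let above (y : E) : {S : Finset ι // S.Nonempty} :=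
    ⟨({i | f y ≤ A i y} : Finset ι), (hsel y).imp fun i hi => by simp [hi]⟩
  let T : Finset {S : Finset ι // S.Nonempty} := {S | minOf S ≤ f}
  have habove : ∀ y, above y ∈ T := fun y => by
    refine Finset.mem_filter.2 ⟨Finset.mem_univ _, fun x => ?_⟩
    obtain ⟨i, hix, hiy⟩ := exists_le_and_ge_of_continuous_selection hf hsel x y
    simp only [minOf, Finset.inf'_apply]
    exact (Finset.inf'_le _ (by simpa [above] using hiy)).trans hix
  have hT : T.Nonempty := ⟨above 0, habove 0⟩
  have hsup : f = T.sup' hT minOf := by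
    refine le_antisymm (fun y => ?_) (Finset.sup'_le _ _ fun S hS => (Finset.mem_filter.1 hS).2)
    have hy : f y ≤ minOf (above y) y := by
      simp only [minOf, Finset.inf'_apply]
      exact Finset.le_inf' _ _ fun i hi => by simpa [above] using hi
    exact hy.trans (Finset.le_sup' minOf (habove y) y)
  rw [hsup]
  exact isSublattice_latticeClosure.supClosed.finsetSup'_mem _ fun S _ =>
    isSublattice_latticeClosure.infClosed.finsetInf'_mem _ fun i _ =>
      subset_latticeClosure ⟨i, rfl⟩

end

theorem IsPolyhedral.isClosed {d : ℕ} {Q : Set (EuclideanSpace ℝ (Fin d))}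
    (hQ : IsPolyhedral Q) : IsClosed Q := by
  obtain ⟨m, c, β, -, rfl⟩ := hQ
  exact isClosed_iInter fun r => isClosed_le (by fun_prop) continuous_const

theorem IsPiecewiseAffine.continuous_and_exists_selection {d : ℕ}
    {f : EuclideanSpace ℝ (Fin d) → ℝ} (hf : IsPiecewiseAffine f) :
    Continuous f ∧ ∃ (k : ℕ) (A : Fin k → EuclideanSpace ℝ (Fin d) →ᵃ[ℝ] ℝ),
      ∀ x, ∃ i, f x = A i x := by
  obtain ⟨k, Q, hQ, hA⟩ := hf
  choose A hA using hA
  refine ⟨(locallyFinite_of_finite Q).continuous hQ.cover (fun i => (hQ.polyhedral i).isClosed)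
    fun i => (A i).continuous_of_finiteDimensional.continuousOn.congr (hA i), k, A, fun x => ?_⟩
  obtain ⟨i, hi⟩ := Set.mem_iUnion.1 (hQ.cover ▸ Set.mem_univ x)
  exact ⟨i, hA i x hi⟩

/-! ### Differences of maxima of affine functions -/

section

variable {E : Type*} [NormedAddCommGroup E] [InnerProductSpace ℝ E]

/-- `g` is the maximum of finitely many affine functions `x ↦ c + ⟪v, x⟫`, encoded as a finite set
of pairs `(c, v)`; these are the convex piecewise affine functions. -/
def IsMaxAffine (g : E → ℝ) : Prop :=
  ∃ T : Set (ℝ × E), T.Finite ∧ ∀ x, IsGreatest ((fun p => p.1 + inner ℝ p.2 x) '' T) (g x)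

/-- `f` is a difference of two maxima of finitely many affine functions: the form of a DC
decomposition that is visibly stable under lattice operations. -/
def IsDiffMaxAffine (f : E → ℝ) : Prop :=
  ∃ g h : E → ℝ, IsMaxAffine g ∧ IsMaxAffine h ∧ f = g - h

theorem isMaxAffine_const_add_inner (c : ℝ) (v : E) : IsMaxAffine fun x => c + inner ℝ v x :=
  ⟨{(c, v)}, Set.finite_singleton _, fun x => by simp⟩

theorem IsMaxAffine.sup {g h : E → ℝ} (hg : IsMaxAffine g) (hh : IsMaxAffine h) :
    IsMaxAffine (g ⊔ h) := by
  obtain ⟨T, hT, hg⟩ := hg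
  obtain ⟨S, hS, hh⟩ := hh
  refine ⟨T ∪ S, hT.union hS, fun x => ?_⟩
  rw [Set.image_union]
  exact (hg x).union (hh x)

theorem IsMaxAffine.add {g h : E → ℝ} (hg : IsMaxAffine g) (hh : IsMaxAffine h) :
    IsMaxAffine (g + h) := by
  obtain ⟨T, hT, hg⟩ := hg
  obtain ⟨S, hS, hh⟩ := hh
  refine ⟨T + S, hT.add hS, fun x => ?_⟩
  have himage : (fun p : ℝ × E => p.1 + inner ℝ p.2 x) '' (T + S) =
      (fun p : ℝ × E => p.1 + inner ℝ p.2 x) '' T +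
        (fun p : ℝ × E => p.1 + inner ℝ p.2 x) '' S :=
    Set.image_image2_distrib fun p q => by
      simp only [Prod.fst_add, Prod.snd_add, inner_add_left]
      ring
  rw [himage]
  exact ⟨Set.add_mem_add (hg x).1 (hh x).1, add_mem_upperBounds_add (hg x).2 (hh x).2⟩

theorem IsMaxAffine.exists_fin {g : E → ℝ} (hg : IsMaxAffine g) :
    ∃ (l : ℕ) (_ : NeZero l) (c : Fin l → ℝ × E),
      ∀ x, IsGreatest (Set.range fun i => (c i).1 + inner ℝ (c i).2 x) (g x) := by
  obtain ⟨T, hT, hg⟩ := hg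
  obtain ⟨l, c, -, rfl⟩ := hT.fin_param
  simp only [← Set.range_comp'] at hg
  obtain ⟨i, -⟩ := (hg 0).1
  exact ⟨l, ⟨fun hl => (hl ▸ i).elim0⟩, c, hg⟩

theorem IsDiffMaxAffine.neg {f : E → ℝ} (hf : IsDiffMaxAffine f) : IsDiffMaxAffine (-f) := by
  obtain ⟨g, h, hg, hh, rfl⟩ := hf
  exact ⟨h, g, hh, hg, neg_sub _ _⟩

theorem IsDiffMaxAffine.sup {f₁ f₂ : E → ℝ} (h₁ : IsDiffMaxAffine f₁) (h₂ : IsDiffMaxAffine f₂) :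
    IsDiffMaxAffine (f₁ ⊔ f₂) := by
  obtain ⟨g₁, k₁, hg₁, hk₁, rfl⟩ := h₁
  obtain ⟨g₂, k₂, hg₂, hk₂, rfl⟩ := h₂
  refine ⟨(g₁ + k₂) ⊔ (g₂ + k₁), k₁ + k₂, (hg₁.add hk₂).sup (hg₂.add hk₁), hk₁.add hk₂, ?_⟩
  ext x
  simp only [Pi.sup_apply, Pi.sub_apply, Pi.add_apply]
  rw [← max_sub_sub_right]
  congr 1 <;> ring

theorem IsDiffMaxAffine.inf {f₁ f₂ : E → ℝ} (h₁ : IsDiffMaxAffine f₁) (h₂ : IsDiffMaxAffine f₂) :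
    IsDiffMaxAffine (f₁ ⊓ f₂) := by
  have h := (h₁.neg.sup h₂.neg).neg
  rwa [neg_sup, neg_neg, neg_neg] at h

theorem isSublattice_isDiffMaxAffine : IsSublattice {f : E → ℝ | IsDiffMaxAffine f} :=
  ⟨fun _ h₁ _ h₂ => h₁.sup h₂, fun _ h₁ _ h₂ => h₁.inf h₂⟩

theorem isDiffMaxAffine_affineMap [FiniteDimensional ℝ E] (A : E →ᵃ[ℝ] ℝ) :
    IsDiffMaxAffine (A : E → ℝ) := by
  let v : E := (InnerProductSpace.toDual ℝ E).symm (LinearMap.toContinuousLinearMap A.linear)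
  have hv : ∀ x, inner ℝ v x = A.linear x := fun x => InnerProductSpace.toDual_symm_apply
  refine ⟨_, _, isMaxAffine_const_add_inner (A 0) v, isMaxAffine_const_add_inner 0 0, ?_⟩
  ext x
  simp [hv, congrFun A.decomp x, add_comm]

end

namespace DCDecomposition

section

variable {d l s : ℕ} (D : DCDecomposition d l s)

theorem isGreatest_convexPart [NeZero l] (x : EuclideanSpace ℝ (Fin d)) :
    IsGreatest (Set.range fun i => D.a i + inner ℝ (D.v i) x) (D.convexPart x) := by
  refine ⟨?_, Set.forall_mem_range.2 fun i =>
    Finset.le_sup' (fun i => D.a i + inner ℝ (D.v i) x) (Finset.mem_univ i)⟩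
  obtain ⟨i, -, hi⟩ := Finset.exists_mem_eq_sup' Finset.univ_nonempty
    fun i => D.a i + inner ℝ (D.v i) x
  exact ⟨i, hi.symm⟩

theorem isLeast_concavePart [NeZero s] (x : EuclideanSpace ℝ (Fin d)) :
    IsLeast (Set.range fun j => D.b j + inner ℝ (D.w j) x) (D.concavePart x) := by
  refine ⟨?_, Set.forall_mem_range.2 fun j => Finset.inf'_le _ (Finset.mem_univ j)⟩
  obtain ⟨j, -, hj⟩ := Finset.exists_mem_eq_inf' Finset.univ_nonempty
    fun j => D.b j + inner ℝ (D.w j) x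
  exact ⟨j, hj.symm⟩

end

end DCDecomposition

theorem IsDiffMaxAffine.exists_represents {d : ℕ} {f : EuclideanSpace ℝ (Fin d) → ℝ}
    (hf : IsDiffMaxAffine f) :
    ∃ (l s : ℕ) (_ : NeZero l) (_ : NeZero s) (D : DCDecomposition d l s), D.Represents f := by
  obtain ⟨g, h, hg, hh, rfl⟩ := hf
  obtain ⟨l, hl, p, hg⟩ := hg.exists_fin
  obtain ⟨s, hs, q, hh⟩ := hh.exists_fin
  let D : DCDecomposition d l s :=
    ⟨fun i => (p i).1, fun i => (p i).2, fun j => -(q j).1, fun j => -(q j).2⟩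
  refine ⟨l, s, hl, hs, D, fun x => ?_⟩
  have hconvex : D.convexPart x = g x := (D.isGreatest_convexPart x).unique (hg x)
  have hneg : Antitone (Neg.neg : ℝ → ℝ) := fun _ _ => neg_le_neg
  have hconcave : D.concavePart x = -h x := by
    refine (D.isLeast_concavePart x).unique ?_
    simpa [D, ← Set.range_comp', inner_neg_left, neg_add, add_comm]
      using hneg.map_isGreatest (hh x)
  rw [hconvex, hconcave, Pi.sub_apply, sub_eq_add_neg]

theorem exists_represents_of_continuous_selection {d : ℕ} {ι : Type*} [Finite ι]
    {f : EuclideanSpace ℝ (Fin d) → ℝ} {A : ι → EuclideanSpace ℝ (Fin d) →ᵃ[ℝ] ℝ}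
    (hf : Continuous f) (hsel : ∀ x, ∃ i, f x = A i x) :
    ∃ (l s : ℕ) (_ : NeZero l) (_ : NeZero s) (D : DCDecomposition d l s), D.Represents f := by
  refine IsDiffMaxAffine.exists_represents (latticeClosure_min ?_ isSublattice_isDiffMaxAffine
    (mem_latticeClosure_of_continuous_selection hf hsel))
  rintro _ ⟨i, rfl⟩
  exact isDiffMaxAffine_affineMap (A i)

/-! ### Convex hulls and nearest points -/

theorem convexHull_inter_setOf_eq_of_forall_le {𝕜 E : Type*} [Field 𝕜] [LinearOrder 𝕜]
    [IsStrictOrderedRing 𝕜] [AddCommGroup E] [Module 𝕜 E] (φ : E →ₗ[𝕜] 𝕜) {s : Set E} {c : 𝕜}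
    (hs : ∀ x ∈ s, c ≤ φ x) :
    convexHull 𝕜 (s ∩ {x | φ x = c}) = convexHull 𝕜 s ∩ {x | φ x = c} := by
  refine Set.Subset.antisymm (convexHull_min (Set.inter_subset_inter_left _
    (subset_convexHull 𝕜 s)) ((convex_convexHull 𝕜 s).inter (convex_hyperplane φ.isLinear c))) ?_
  have hconv : Convex 𝕜 {x | c < φ x ∨ φ x = c ∧ x ∈ convexHull 𝕜 (s ∩ {x | φ x = c})} := by
    refine convex_iff_forall_pos.2 fun x hx y hy a b ha hb hab => ?_
    simp only [Set.mem_ofPred_eq, map_add, map_smul, smul_eq_mul] at hx hy ⊢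
    have hc : a * c + b * c = c := by rw [← add_mul, hab, one_mul]
    rcases hx with hx | ⟨hx, hx'⟩ <;> rcases hy with hy | ⟨hy, hy'⟩
    · left; nlinarith
    · left; nlinarith
    · left; nlinarith
    · exact .inr ⟨by rw [hx, hy, hc], convex_convexHull 𝕜 _ hx' hy' ha.le hb.le hab⟩
  rintro p ⟨hp, hpc⟩
  have hsub : s ⊆ {x | c < φ x ∨ φ x = c ∧ x ∈ convexHull 𝕜 (s ∩ {x | φ x = c})} := fun x hx =>
    (hs x hx).lt_or_eq.imp_right fun h => ⟨h.symm, subset_convexHull 𝕜 _ ⟨hx, h.symm⟩⟩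
  exact ((convexHull_min hsub hconv hp).resolve_left hpc.not_gt).2

theorem convexHull_add_singleton (𝕜 : Type*) {E : Type*} [Field 𝕜] [LinearOrder 𝕜]
    [IsStrictOrderedRing 𝕜] [AddCommGroup E] [Module 𝕜 E] (s : Set E) (c : E) :
    convexHull 𝕜 s + {c} = convexHull 𝕜 ((· + c) '' s) := by
  rw [← convexHull_singleton (𝕜 := 𝕜) c, ← convexHull_add, Set.add_singleton]

section

variable {F : Type*} [NormedAddCommGroup F] [InnerProductSpace ℝ F]

theorem norm_sq_le_inner_of_forall_norm_le {K : Set F} (hK : Convex ℝ K) {p : F} (hp : p ∈ K)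
    (hmin : ∀ q ∈ K, ‖p‖ ≤ ‖q‖) {q : F} (hq : q ∈ K) : ‖p‖ ^ 2 ≤ inner ℝ p q := by
  have : Nonempty K := ⟨⟨p, hp⟩⟩
  have hinf : ‖0 - p‖ = ⨅ w : K, ‖0 - (w : F)‖ := by
    simp only [zero_sub, norm_neg]
    exact le_antisymm (le_ciInf fun w => hmin w w.2)
      (ciInf_le ⟨0, Set.forall_mem_range.2 fun w => norm_nonneg _⟩ (⟨p, hp⟩ : K))
  have h := (norm_eq_iInf_iff_real_inner_le_zero hK hp).1 hinf q hq
  rw [zero_sub, inner_neg_left, inner_sub_right, real_inner_self_eq_norm_sq] at h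
  linarith

/-- A maximum of affine functions whose gradients have no `0` in their convex hull tends to `-∞`
along minus the gradient of least norm. -/
theorem zero_mem_convexHull_range_of_forall_exists_le {ι : Type*} [Finite ι] {a : ι → ℝ}
    {u : ι → F} {c : ℝ} (h : ∀ x, ∃ i, c ≤ a i + inner ℝ (u i) x) :
    (0 : F) ∈ convexHull ℝ (Set.range u) := by
  obtain ⟨i₀, hi₀⟩ := h 0
  obtain ⟨p, hp, hmin⟩ := ((Set.finite_range u).isCompact_convexHull ℝ).exists_isMinOn
    ⟨u i₀, subset_convexHull ℝ _ ⟨i₀, rfl⟩⟩ continuous_norm.continuousOn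
  by_contra h0
  have hpos : 0 < ‖p‖ ^ 2 := by
    have : p ≠ 0 := fun hp0 => h0 (hp0 ▸ hp)
    positivity
  obtain ⟨B, hB⟩ := (Set.finite_range a).bddAbove
  have hcB : c ≤ B := by
    rw [inner_zero_right, add_zero] at hi₀
    exact hi₀.trans (hB ⟨i₀, rfl⟩)
  set t := (B - c + 1) / ‖p‖ ^ 2
  have ht : 0 ≤ t := div_nonneg (by linarith) hpos.le
  obtain ⟨i, hi⟩ := h (-t • p)
  have hinner := norm_sq_le_inner_of_forall_norm_le (convex_convexHull ℝ _) hp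
    (fun q hq => hmin hq) (subset_convexHull ℝ _ ⟨i, rfl⟩)
  rw [inner_smul_right, real_inner_comm] at hi
  have htp : t * ‖p‖ ^ 2 = B - c + 1 := div_mul_cancel₀ _ hpos.ne'
  linarith [hB ⟨i, rfl⟩, mul_le_mul_of_nonneg_left hinner ht]

end

theorem isGreatest_image_convexHull {𝕜 E : Type*} [Field 𝕜] [LinearOrder 𝕜]
    [IsStrictOrderedRing 𝕜] [AddCommGroup E] [Module 𝕜 E] (φ : E →ₗ[𝕜] 𝕜) {s : Set E} {c : 𝕜}
    (h : IsGreatest (φ '' s) c) : IsGreatest (φ '' convexHull 𝕜 s) c :=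
  ⟨Set.image_mono (subset_convexHull 𝕜 s) h.1, Set.forall_mem_image.2 <|
    convexHull_min (fun _ hx => h.2 ⟨_, hx, rfl⟩) (convex_halfSpace_le φ.isLinear c)⟩

theorem inner_withLp_real_prod {F : Type*} [NormedAddCommGroup F] [InnerProductSpace ℝ F]
    (p q : WithLp 2 (ℝ × F)) : inner ℝ p q = p.fst * q.fst + inner ℝ p.snd q.snd := by
  rw [WithLp.prod_inner_apply, mul_comm]
  rfl

namespace DCDecomposition

section

variable {d l s : ℕ} (D : DCDecomposition d l s)

/-! ### The constant `min {θ, 1}` -/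

theorem finite_gradientSets : D.gradientSets.Finite := by
  refine (Set.finite_range fun p : Set (Fin l) × Fin s =>
    convexHull ℝ (D.v '' p.1) + {D.w p.2}).subset ?_
  rintro C ⟨⟨S, -, j, rfl⟩, -⟩
  exact ⟨(S, j), rfl⟩

theorem isClosed_of_mem_gradientSets {C : Set (EuclideanSpace ℝ (Fin d))}
    (hC : C ∈ D.gradientSets) : IsClosed C := by
  obtain ⟨⟨S, -, j, rfl⟩, -⟩ := hC
  exact (((S.toFinite.image _).isCompact_convexHull ℝ).add isCompact_singleton).isClosed

theorem minThetaOne_pos : 0 < D.minThetaOne := by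
  have hclosed : IsClosed (⋃ C ∈ D.gradientSets, C) :=
    D.finite_gradientSets.isClosed_biUnion fun C => D.isClosed_of_mem_gradientSets
  have hzero : (0 : EuclideanSpace ℝ (Fin d)) ∈ (⋃ C ∈ D.gradientSets, C)ᶜ := by
    simp only [Set.mem_compl_iff, Set.mem_iUnion, not_exists]
    exact fun C hC => hC.2
  obtain ⟨ε, hε, hball⟩ := Metric.isOpen_iff.1 hclosed.isOpen_compl 0 hzero
  refine (lt_min one_pos (pow_pos hε 2)).trans_le (le_csInf (Set.insert_nonempty _ _) ?_)
  rintro r (rfl | ⟨C, hC, v, hv, rfl⟩)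
  · exact min_le_left _ _
  · refine (min_le_right _ _).trans (pow_le_pow_left₀ hε.le ?_ 2)
    by_contra! hlt
    exact hball (mem_ball_zero_iff.2 hlt) (Set.mem_biUnion hC hv)

theorem bddBelow_insert_one_norm_sq :
    BddBelow (insert 1 {r : ℝ | ∃ C ∈ D.gradientSets, ∃ v ∈ C, r = ‖v‖ ^ 2}) := by
  refine ⟨0, ?_⟩
  rintro r (rfl | ⟨C, -, v, -, rfl⟩) <;> positivity

theorem minThetaOne_le_one : D.minThetaOne ≤ 1 :=
  csInf_le D.bddBelow_insert_one_norm_sq (Set.mem_insert _ _)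

theorem minThetaOne_le_norm_sq {C : Set (EuclideanSpace ℝ (Fin d))} (hC : C ∈ D.gradientSets)
    {v : EuclideanSpace ℝ (Fin d)} (hv : v ∈ C) : D.minThetaOne ≤ ‖v‖ ^ 2 :=
  csInf_le D.bddBelow_insert_one_norm_sq (.inr ⟨C, hC, v, hv, rfl⟩)

theorem add_floor_le_mul_nStar [NeZero s] (f : EuclideanSpace ℝ (Fin d) → ℝ)
    (x₀ : EuclideanSpace ℝ (Fin d)) :
    s + ⌊(f x₀ - ⨅ y, f y) / D.minThetaOne⌋₊ ≤ s * D.nStar f x₀ := by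
  rw [nStar, mul_add_one, add_comm]
  gcongr
  exact Nat.le_mul_of_pos_left _ (NeZero.pos s)

end

noncomputable section

variable {d l s : ℕ} [NeZero l] {D : DCDecomposition d l s}

/-! ### Branches and codifferentials -/

/-- The `j`-th convex branch `max_i (a_i + ⟨v_i, y⟩) + (b_j + ⟨w_j, y⟩)`; the function with the
decomposition `D` is the minimum of the branches. -/
def branch (D : DCDecomposition d l s) (j : Fin s) (y : EuclideanSpace ℝ (Fin d)) : ℝ :=
  D.convexPart y + (D.b j + inner ℝ (D.w j) y)

variable [NeZero s] {f : EuclideanSpace ℝ (Fin d) → ℝ}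

theorem Represents.le_branch (hf : D.Represents f) (j : Fin s) (y : EuclideanSpace ℝ (Fin d)) :
    f y ≤ D.branch j y := by
  rw [hf y, branch]
  gcongr
  exact (D.isLeast_concavePart y).2 ⟨j, rfl⟩

theorem Represents.exists_eq_branch (hf : D.Represents f) (y : EuclideanSpace ℝ (Fin d)) :
    ∃ j, f y = D.branch j y := by
  obtain ⟨j, hj⟩ := (D.isLeast_concavePart y).1
  exact ⟨j, by rw [hf y, branch, ← hj]⟩

theorem Represents.zero_mem_convexHull_add (hf : D.Represents f) (hb : BddBelow (Set.range f))
    (j : Fin s) : (0 : EuclideanSpace ℝ (Fin d)) ∈ convexHull ℝ (Set.range D.v) + {D.w j} := by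
  obtain ⟨c, hc⟩ := hb
  rw [convexHull_add_singleton, ← Set.range_comp]
  refine zero_mem_convexHull_range_of_forall_exists_le (a := fun i => D.a i + D.b j) (c := c)
    fun x => ?_
  obtain ⟨i, hi⟩ := (D.isGreatest_convexPart x).1
  refine ⟨i, (hc ⟨x, rfl⟩).trans ((hf.le_branch j x).trans_eq ?_)⟩
  simp only [branch, ← hi, Function.comp_apply, inner_add_left]
  ring

/-- The points, indexed by `i`, whose convex hull is the codifferential polytope
`hypodiff x + z_j(x)`. -/
def vertex (D : DCDecomposition d l s) (x : EuclideanSpace ℝ (Fin d)) (j : Fin s) (i : Fin l) :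
    WithLp 2 (ℝ × EuclideanSpace ℝ (Fin d)) :=
  WithLp.toLp 2 (D.a i - D.convexPart x + inner ℝ (D.v i) x, D.v i) + D.z x j

/-- The indices of the vertices of `hypodiff x + z_j(x)` on the face exposed by its point
`proj x j` of least norm. -/
def nearestFace (D : DCDecomposition d l s) (x : EuclideanSpace ℝ (Fin d)) (j : Fin s) :
    Set (Fin l) :=
  {i | inner ℝ (D.proj x j) (D.vertex x j i) = ‖D.proj x j‖ ^ 2}

variable (D) in
theorem hypodiff_add_z (x : EuclideanSpace ℝ (Fin d)) (j : Fin s) :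
    D.hypodiff x + {D.z x j} = convexHull ℝ (Set.range (D.vertex x j)) := by
  rw [hypodiff, convexHull_add_singleton, ← Set.range_comp]
  rfl

variable (D) in
theorem image_snd_convexHull_image_vertex (x : EuclideanSpace ℝ (Fin d)) (j : Fin s)
    (S : Set (Fin l)) :
    WithLp.snd '' convexHull ℝ (D.vertex x j '' S) = convexHull ℝ (D.v '' S) + {D.w j} := by
  rw [convexHull_add_singleton, Set.image_image]
  change WithLp.sndₗ 2 ℝ ℝ (EuclideanSpace ℝ (Fin d)) '' _ = _
  rw [LinearMap.image_convexHull, Set.image_image]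
  rfl

theorem norm_sq_proj_le_inner {x : EuclideanSpace ℝ (Fin d)} {j : Fin s}
    {q : WithLp 2 (ℝ × EuclideanSpace ℝ (Fin d))} (hq : q ∈ D.hypodiff x + {D.z x j}) :
    ‖D.proj x j‖ ^ 2 ≤ inner ℝ (D.proj x j) q := by
  have hconv : Convex ℝ (D.hypodiff x + {D.z x j}) :=
    (convex_convexHull ℝ _).add (convex_singleton _)
  exact norm_sq_le_inner_of_forall_norm_le hconv (D.proj_mem x j) (fun q => D.norm_proj_le x j) hq

variable (D) in
theorem convexHull_image_vertex_nearestFace (x : EuclideanSpace ℝ (Fin d)) (j : Fin s) :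
    convexHull ℝ (D.vertex x j '' D.nearestFace x j) =
      (D.hypodiff x + {D.z x j}) ∩ {q | inner ℝ (D.proj x j) q = ‖D.proj x j‖ ^ 2} := by
  have hle : ∀ q ∈ Set.range (D.vertex x j), ‖D.proj x j‖ ^ 2 ≤ innerₗ _ (D.proj x j) q :=
    fun q hq => norm_sq_proj_le_inner (D.hypodiff_add_z x j ▸ subset_convexHull ℝ _ hq)
  have hface := convexHull_inter_setOf_eq_of_forall_le (innerₗ _ (D.proj x j)) hle
  rw [Set.inter_comm, ← Set.image_preimage_eq_inter_range] at hface
  rw [hypodiff_add_z]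
  exact hface

theorem Represents.vertex_fst_add_inner (hf : D.Represents f) (x y : EuclideanSpace ℝ (Fin d))
    (j : Fin s) (i : Fin l) :
    (D.vertex x j i).fst + inner ℝ (D.vertex x j i).snd (y - x) =
      D.a i + inner ℝ (D.v i) y + (D.b j + inner ℝ (D.w j) y - f x) := by
  simp only [hf x, vertex, z, WithLp.add_fst, WithLp.add_snd, WithLp.toLp_fst, WithLp.toLp_snd,
    inner_add_left, inner_sub_right]
  ring

theorem Represents.isGreatest_codifferential (hf : D.Represents f)
    (x y : EuclideanSpace ℝ (Fin d)) (j : Fin s) :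
    IsGreatest ((fun q => q.fst + inner ℝ q.snd (y - x)) '' (D.hypodiff x + {D.z x j}))
      (D.branch j y - f x) := by
  have hlin : (fun q => q.fst + inner ℝ q.snd (y - x)) =
      innerₗ (WithLp 2 (ℝ × EuclideanSpace ℝ (Fin d))) (WithLp.toLp 2 (1, y - x)) := by
    ext q
    simp [real_inner_comm]
  have hmono : Monotone fun t => t + (D.b j + inner ℝ (D.w j) y - f x) :=
    add_left_mono
  have hgreatest := hmono.map_isGreatest (D.isGreatest_convexPart y)
  rw [hypodiff_add_z, hlin]
  refine isGreatest_image_convexHull _ ?_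
  rw [← hlin, branch, add_sub_assoc]
  simpa only [← Set.range_comp', hf.vertex_fst_add_inner] using hgreatest

/-! ### One step of the method -/

theorem Represents.branch_trial_le (hf : D.Represents f) {x : EuclideanSpace ℝ (Fin d)}
    {j : Fin s} (ha : (D.proj x j).fst < 0) :
    D.branch j (D.trial x j) ≤ f x + ‖D.proj x j‖ ^ 2 / (D.proj x j).fst := by
  obtain ⟨q, hq, hqeq⟩ := (hf.isGreatest_codifferential x (D.trial x j) j).1
  have hval : D.branch j (D.trial x j) - f x = inner ℝ (D.proj x j) q / (D.proj x j).fst := by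
    rw [← hqeq, inner_withLp_real_prod, trial, add_sub_cancel_left]
    simp only [inner_smul_right, real_inner_comm]
    field [ha.ne]
  have hdiv := div_le_div_of_nonpos_of_le ha.le (norm_sq_proj_le_inner hq)
  linarith

theorem Represents.branch_trial_lt (hf : D.Represents f) {x : EuclideanSpace ℝ (Fin d)}
    {j : Fin s} (ha : (D.proj x j).fst < 0) : D.branch j (D.trial x j) < f x := by
  have hp : D.proj x j ≠ 0 := fun h => by simp [h] at ha
  have hdiv : ‖D.proj x j‖ ^ 2 / (D.proj x j).fst < 0 :=
    div_neg_of_pos_of_neg (by positivity) ha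
  linarith [hf.branch_trial_le ha]

theorem Represents.nonneg_of_le_branch (hf : D.Represents f) {x : EuclideanSpace ℝ (Fin d)}
    {j : Fin s} (h : ∀ y, f x ≤ D.branch j y) : 0 ≤ (D.proj x j).fst :=
  not_lt.1 fun ha => (h _).not_gt (hf.branch_trial_lt ha)

theorem Represents.add_fst_le_branch (hf : D.Represents f) {x : EuclideanSpace ℝ (Fin d)}
    {j : Fin s} {q : WithLp 2 (ℝ × EuclideanSpace ℝ (Fin d))} (hq : q ∈ D.hypodiff x + {D.z x j})
    (hq0 : q.snd = 0) (y : EuclideanSpace ℝ (Fin d)) : f x + q.fst ≤ D.branch j y := by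
  have h := (hf.isGreatest_codifferential x y j).2 ⟨q, hq, rfl⟩
  simp only [hq0, inner_zero_left, add_zero] at h
  linarith

theorem Represents.le_branch_of_nonneg (hf : D.Represents f) (hb : BddBelow (Set.range f))
    {x : EuclideanSpace ℝ (Fin d)} {j : Fin s} (ha : 0 ≤ (D.proj x j).fst)
    (y : EuclideanSpace ℝ (Fin d)) : f x ≤ D.branch j y := by
  suffices ∃ q ∈ D.hypodiff x + {D.z x j}, q.snd = 0 ∧ 0 ≤ q.fst by
    obtain ⟨q, hq, hq0, hfst⟩ := this
    linarith [hf.add_fst_le_branch hq hq0 y]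
  by_cases hp : D.proj x j = 0
  · exact ⟨D.proj x j, D.proj_mem x j, by simp [hp], ha⟩
  · have h0 := hf.zero_mem_convexHull_add hb j
    rw [← Set.image_univ, ← D.image_snd_convexHull_image_vertex x, Set.image_univ,
      ← hypodiff_add_z] at h0
    obtain ⟨q, hq, hq0⟩ := h0
    have hinner := norm_sq_proj_le_inner hq
    rw [inner_withLp_real_prod, hq0, inner_zero_right, add_zero] at hinner
    have hpos : 0 < ‖D.proj x j‖ ^ 2 := by positivity
    exact ⟨q, hq, hq0, (pos_of_mul_pos_right (hpos.trans_le hinner) ha).le⟩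

theorem Represents.trial_le_branch_of_zero_mem (hf : D.Represents f)
    {x : EuclideanSpace ℝ (Fin d)} {j : Fin s} (ha : (D.proj x j).fst < 0)
    (h0 : (0 : EuclideanSpace ℝ (Fin d)) ∈ convexHull ℝ (D.v '' D.nearestFace x j) + {D.w j})
    (y : EuclideanSpace ℝ (Fin d)) : f (D.trial x j) ≤ D.branch j y := by
  rw [← D.image_snd_convexHull_image_vertex x, convexHull_image_vertex_nearestFace] at h0
  obtain ⟨q, ⟨hq, hqface⟩, hq0⟩ := h0
  have hfst : q.fst = ‖D.proj x j‖ ^ 2 / (D.proj x j).fst := by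
    rw [Set.mem_ofPred_eq, inner_withLp_real_prod, hq0, inner_zero_right, add_zero] at hqface
    rw [← hqface, mul_div_cancel_left₀ _ ha.ne]
  calc f (D.trial x j) ≤ D.branch j (D.trial x j) := hf.le_branch j _
    _ ≤ f x + q.fst := hfst ▸ hf.branch_trial_le ha
    _ ≤ D.branch j y := hf.add_fst_le_branch hq hq0 y

theorem Represents.trial_le_sub_of_zero_notMem (hf : D.Represents f)
    {x : EuclideanSpace ℝ (Fin d)} {j : Fin s} (ha : (D.proj x j).fst < 0)
    (h0 : (0 : EuclideanSpace ℝ (Fin d)) ∉ convexHull ℝ (D.v '' D.nearestFace x j) + {D.w j}) :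
    f (D.trial x j) ≤ f x - D.minThetaOne := by
  have hface : D.proj x j ∈ convexHull ℝ (D.vertex x j '' D.nearestFace x j) := by
    rw [convexHull_image_vertex_nearestFace]
    exact ⟨D.proj_mem x j, real_inner_self_eq_norm_sq _⟩
  have hne : (D.nearestFace x j).Nonempty :=
    Set.image_nonempty.1 ((convexHull_nonempty_iff (𝕜 := ℝ)).1 ⟨_, hface⟩)
  have hsnd : (D.proj x j).snd ∈ convexHull ℝ (D.v '' D.nearestFace x j) + {D.w j} := by
    rw [← D.image_snd_convexHull_image_vertex x]
    exact ⟨_, hface, rfl⟩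
  have hθ : D.minThetaOne ≤ ‖(D.proj x j).snd‖ ^ 2 :=
    D.minThetaOne_le_norm_sq ⟨⟨_, hne, j, rfl⟩, h0⟩ hsnd
  have hdrop : ‖D.proj x j‖ ^ 2 / (D.proj x j).fst ≤ -D.minThetaOne := by
    rw [div_le_iff_of_neg ha, WithLp.prod_norm_sq_eq_of_L2, Real.norm_eq_abs, sq_abs]
    nlinarith [D.minThetaOne_le_one, D.minThetaOne_pos, sq_nonneg ((D.proj x j).fst + 1)]
  linarith [hf.le_branch j (D.trial x j), hf.branch_trial_le ha]

end

end DCDecomposition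

theorem floor_div_add_one_le_floor_div {K : Type*} [Field K] [LinearOrder K]
    [IsStrictOrderedRing K] [FloorSemiring K] {a b θ : K} (hθ : 0 < θ) (hb : 0 ≤ b)
    (h : b ≤ a - θ) : ⌊b / θ⌋₊ + 1 ≤ ⌊a / θ⌋₊ := by
  rw [← Nat.floor_add_one (div_nonneg hb hθ.le), div_add_one hθ.ne']
  gcongr
  linarith

namespace DCDecomposition

noncomputable section

variable {d l s : ℕ} [NeZero l] [NeZero s] {D : DCDecomposition d l s}
  {f : EuclideanSpace ℝ (Fin d) → ℝ} {x₀ : EuclideanSpace ℝ (Fin d)}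
  {x : ℕ → EuclideanSpace ℝ (Fin d)} {M : ℕ → Set (Fin s)} {n : ℕ}

/-! ### Runs of the method -/

theorem exists_isRun (D : DCDecomposition d l s) (f : EuclideanSpace ℝ (Fin d) → ℝ)
    (x₀ : EuclideanSpace ℝ (Fin d)) : ∃ x M, D.IsRun f x₀ x M := by
  have hmin : ∀ (x : EuclideanSpace ℝ (Fin d)) (M : Set (Fin s)), M.Nonempty →
      ∃ j ∈ M, ∀ i ∈ M, f (D.trial x j) ≤ f (D.trial x i) := fun x M hM =>
    M.exists_min_image (fun j => f (D.trial x j)) M.toFinite hM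
  choose! sel hsel_mem hsel_le using hmin
  let next (q : EuclideanSpace ℝ (Fin d) × Set (Fin s)) : EuclideanSpace ℝ (Fin d) × Set (Fin s) :=
    (D.trial q.1 (sel q.1 q.2), q.2 \ {j | 0 ≤ (D.proj (D.trial q.1 (sel q.1 q.2)) j).fst})
  let state (n : ℕ) := next^[n] (x₀, Set.univ \ {j | 0 ≤ (D.proj x₀ j).fst})
  have hstate : ∀ n, state (n + 1) = next (state n) := fun n => Function.iterate_succ_apply' _ _ _
  refine ⟨fun n => (state n).1, fun n => (state n).2, rfl, rfl, fun n hn => ?_, fun n _ => ?_⟩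
  · exact ⟨sel (state n).1 (state n).2, hsel_mem _ _ hn, hsel_le _ _ hn, by rw [hstate]⟩
  · simp only [hstate, next]

/-- The sequences `x` and `M` are produced by codifferential descent with an arbitrary choice of
the index `j ∈ M n` in each step. As in `IsRun`, nothing is required after the first `n` with
`M n = ∅`. -/
structure IsDescent (D : DCDecomposition d l s) (x : ℕ → EuclideanSpace ℝ (Fin d))
    (M : ℕ → Set (Fin s)) : Prop where
  discard_zero : M 0 = Set.univ \ {j | 0 ≤ (D.proj (x 0) j).fst}
  step : ∀ n, (M n).Nonempty → ∃ j ∈ M n, x (n + 1) = D.trial (x n) j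
  discard_succ : ∀ n, (M n).Nonempty →
    M (n + 1) = M n \ {j | 0 ≤ (D.proj (x (n + 1)) j).fst}

theorem IsRun.isDescent (h : D.IsRun f x₀ x M) : D.IsDescent x M where
  discard_zero := h.discard_zero
  step n hn := (h.step n hn).imp fun _ hj => ⟨hj.1, hj.2.2⟩
  discard_succ := h.discard_succ

/-- The number of surviving indices plus the number of decreases of `f` by `min {θ, 1}` for which
there is still room above `inf f`; a natural number that decreases along the method. -/
def potential (D : DCDecomposition d l s) (f : EuclideanSpace ℝ (Fin d) → ℝ)
    (x : EuclideanSpace ℝ (Fin d)) (M : Set (Fin s)) : ℕ :=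
  M.ncard + ⌊(f x - ⨅ y, f y) / D.minThetaOne⌋₊

namespace IsDescent

theorem fst_proj_neg (h : D.IsDescent x M) (hn : ∀ k < n, (M k).Nonempty) {j : Fin s}
    (hj : j ∈ M n) : (D.proj (x n) j).fst < 0 := by
  cases n with
  | zero =>
    rw [h.discard_zero] at hj
    exact not_le.1 hj.2
  | succ n =>
    rw [h.discard_succ n (hn n n.lt_succ_self)] at hj
    exact not_le.1 hj.2

theorem exists_step (h : D.IsDescent x M) (hn : ∀ k ≤ n, (M k).Nonempty) :
    ∃ j ∈ M n, (D.proj (x n) j).fst < 0 ∧ x (n + 1) = D.trial (x n) j := by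
  obtain ⟨j, hj, hx⟩ := h.step n (hn n le_rfl)
  exact ⟨j, hj, h.fst_proj_neg (fun k hk => hn k hk.le) hj, hx⟩

theorem apply_succ_le (h : D.IsDescent x M) (hf : D.Represents f) (hn : ∀ k ≤ n, (M k).Nonempty) :
    f (x (n + 1)) ≤ f (x n) := by
  obtain ⟨j, -, hneg, hx⟩ := h.exists_step hn
  rw [hx]
  exact (hf.le_branch j _).trans (hf.branch_trial_lt hneg).le

theorem ssubset_or_apply_succ_le_sub (h : D.IsDescent x M) (hf : D.Represents f)
    (hn : ∀ k ≤ n, (M k).Nonempty) :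
    M (n + 1) ⊂ M n ∨ f (x (n + 1)) ≤ f (x n) - D.minThetaOne := by
  obtain ⟨j, hj, hneg, hx⟩ := h.exists_step hn
  by_cases h0 : 0 ∈ convexHull ℝ (D.v '' D.nearestFace (x n) j) + {D.w j}
  · left
    have hnonneg : 0 ≤ (D.proj (x (n + 1)) j).fst :=
      hf.nonneg_of_le_branch (hx ▸ hf.trial_le_branch_of_zero_mem hneg h0)
    rw [h.discard_succ n (hn n le_rfl), Set.sdiff_ssubset_left_iff]
    exact ⟨j, hj, hnonneg⟩
  · exact .inr (hx ▸ hf.trial_le_sub_of_zero_notMem hneg h0)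

theorem potential_succ_lt (h : D.IsDescent x M) (hf : D.Represents f)
    (hb : BddBelow (Set.range f)) (hn : ∀ k ≤ n, (M k).Nonempty) :
    D.potential f (x (n + 1)) (M (n + 1)) < D.potential f (x n) (M n) := by
  rcases h.ssubset_or_apply_succ_le_sub hf hn with hM | hdrop
  · refine add_lt_add_of_lt_of_le (Set.ncard_lt_ncard hM) (Nat.floor_le_floor ?_)
    have := D.minThetaOne_pos
    have := h.apply_succ_le hf hn
    gcongr
  · have hsub : M (n + 1) ⊆ M n := h.discard_succ n (hn n le_rfl) ▸ Set.sdiff_subset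
    refine add_lt_add_of_le_of_lt (Set.ncard_le_ncard hsub) (Nat.lt_of_succ_le ?_)
    exact floor_div_add_one_le_floor_div D.minThetaOne_pos (sub_nonneg.2 (ciInf_le hb _))
      (by linarith)

theorem add_potential_le (h : D.IsDescent x M) (hf : D.Represents f)
    (hb : BddBelow (Set.range f)) (hn : ∀ k < n, (M k).Nonempty) :
    n + D.potential f (x n) (M n) ≤ D.potential f (x 0) (M 0) := by
  induction n with
  | zero => rw [zero_add]
  | succ n ih =>
    have hlt := h.potential_succ_lt hf hb fun k hk => hn k (Nat.lt_succ_of_le hk)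
    have hle := ih fun k hk => hn k (hk.trans n.lt_succ_self)
    omega

theorem le_branch_of_notMem (h : D.IsDescent x M) (hf : D.Represents f)
    (hb : BddBelow (Set.range f)) (hn : ∀ k < n, (M k).Nonempty) {j : Fin s} (hj : j ∉ M n)
    (y : EuclideanSpace ℝ (Fin d)) : f (x n) ≤ D.branch j y := by
  induction n with
  | zero =>
    rw [h.discard_zero] at hj
    exact hf.le_branch_of_nonneg hb (by simpa using hj) y
  | succ n ih =>
    by_cases hjn : j ∈ M n
    · rw [h.discard_succ n (hn n n.lt_succ_self)] at hj
      exact hf.le_branch_of_nonneg hb (by simpa [hjn] using hj) y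
    · exact (h.apply_succ_le hf fun k hk => hn k (Nat.lt_succ_of_le hk)).trans
        (ih (fun k hk => hn k (hk.trans n.lt_succ_self)) hjn)

theorem exists_termination (h : D.IsDescent x M) (hf : D.Represents f)
    (hb : BddBelow (Set.range f)) :
    ∃ N ≤ s + ⌊(f (x 0) - ⨅ y, f y) / D.minThetaOne⌋₊,
      M N = ∅ ∧ (∀ n < N, (M n).Nonempty) ∧ ∀ y, f (x N) ≤ f y := by
  classical
  have hbound : ∀ n, (∀ k < n, (M k).Nonempty) →
      n + (M n).ncard ≤ s + ⌊(f (x 0) - ⨅ y, f y) / D.minThetaOne⌋₊ := fun n hn => by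
    have hle := h.add_potential_le hf hb hn
    have hcard : (M 0).ncard ≤ s := by simpa using Set.ncard_le_card (M 0)
    simp only [potential] at hle
    omega
  have hterminates : ∃ N, M N = ∅ := by
    by_contra! hne
    have hle := hbound (s + ⌊(f (x 0) - ⨅ y, f y) / D.minThetaOne⌋₊ + 1) fun k _ => hne k
    omega
  have hbefore : ∀ n < Nat.find hterminates, (M n).Nonempty := fun n hn =>
    Set.nonempty_iff_ne_empty.2 (Nat.find_min hterminates hn)
  have hempty : M (Nat.find hterminates) = ∅ := Nat.find_spec hterminates
  refine ⟨Nat.find hterminates, le_self_add.trans (hbound _ hbefore), hempty, hbefore, fun y => ?_⟩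
  obtain ⟨j, hj⟩ := hf.exists_eq_branch y
  rw [hj]
  exact h.le_branch_of_notMem hf hb hbefore (by simp [hempty]) y

end IsDescent

end

end DCDecomposition

theorem theorem3_general {d : ℕ} {ι : Type*} [Finite ι] {f : EuclideanSpace ℝ (Fin d) → ℝ}
    {A : ι → EuclideanSpace ℝ (Fin d) →ᵃ[ℝ] ℝ} (hf : Continuous f) (hsel : ∀ x, ∃ i, f x = A i x)
    (hb : BddBelow (Set.range f)) :
    (∃ x, ∀ y, f x ≤ f y) ∧
    (∃ (l s : ℕ) (_ : NeZero l) (_ : NeZero s) (D : DCDecomposition d l s), D.Represents f) ∧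
    ∀ (l s : ℕ) [NeZero l] [NeZero s] (D : DCDecomposition d l s), D.Represents f →
      (∀ x₀ : EuclideanSpace ℝ (Fin d), ∃ x M, D.IsRun f x₀ x M) ∧
      ∀ (x : ℕ → EuclideanSpace ℝ (Fin d)) (M : ℕ → Set (Fin s)), D.IsDescent x M →
        ∃ N ≤ s + ⌊(f (x 0) - ⨅ y, f y) / D.minThetaOne⌋₊,
          M N = ∅ ∧ (∀ n < N, (M n).Nonempty) ∧ ∀ y, f (x N) ≤ f y := by
  have hrep := exists_represents_of_continuous_selection hf hsel
  refine ⟨?_, hrep, fun l s _ _ D hD => ⟨D.exists_isRun f, fun x M h => h.exists_termination hD hb⟩⟩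
  obtain ⟨l, s, _, _, D, hD⟩ := hrep
  obtain ⟨x, M, h⟩ := D.exists_isRun f 0
  obtain ⟨N, -, -, -, hN⟩ := h.isDescent.exists_termination hD hb
  exact ⟨x N, hN⟩

theorem theorem3 {d : ℕ} (f : EuclideanSpace ℝ (Fin d) → ℝ) (hf : IsPiecewiseAffine f)
    (hb : BddBelow (Set.range f)) :
    (∃ x, ∀ y, f x ≤ f y) ∧
    (∃ (l s : ℕ) (_ : NeZero l) (_ : NeZero s) (D : DCDecomposition d l s), D.Represents f) ∧
    ∀ (l s : ℕ) [NeZero l] [NeZero s] (D : DCDecomposition d l s), D.Represents f →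
      ∀ x₀ : EuclideanSpace ℝ (Fin d),
        (∃ x M, D.IsRun f x₀ x M) ∧
        ∀ (x : ℕ → EuclideanSpace ℝ (Fin d)) (M : ℕ → Set (Fin s)), D.IsRun f x₀ x M →
          ∃ N ≤ s * D.nStar f x₀,
            M N = ∅ ∧ (∀ n < N, (M n).Nonempty) ∧ ∀ y, f (x N) ≤ f y := by
  obtain ⟨hcont, k, A, hsel⟩ := hf.continuous_and_exists_selection
  obtain ⟨hmin, hrep, hdescent⟩ := theorem3_general hcont hsel hb
  refine ⟨hmin, hrep, fun l s _ _ D hD x₀ => ⟨(hdescent l s D hD).1 x₀, fun x M h => ?_⟩⟩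
  obtain ⟨N, hN, hterm⟩ := (hdescent l s D hD).2 x M h.isDescent
  exact ⟨N, (h.start ▸ hN).trans (D.add_floor_le_mul_nStar f x₀), hterm⟩
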